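/- Let $M$ be a smooth $n$-dimensional manifold and $\lambda:LM\to M$ its bundle of linear frames $u=(x,e_1,\dots,e_n)$, with the right action $(x,e_i)\cdot g=(x,e_j g^j_i)$ of $GL(n,\mathbb R)$. Identify $TM$ with the associated bundle $LM\times_{GL(n,\mathbb R)}\mathbb R^n$ by $[(x,e_i),\xi]=\xi^ie_i\in T_xM$. Let $\tilde TM$ be $TM$ without its zero section, $\tau:\tilde TM\to M$ the projection, and for $0\neq\xi\in\mathbb R^n$ let $\psi_\xi:LM\to\tilde TM$, $\psi_\xi(u)=[u,\xi]$. For $A\in gl(n,\mathbb R)$ let $A^*(u)=\frac{d}{dt}\big|_{t=0}\,u\cdot\exp(tA)$; let $E^i_j$ be the elementary matrix with entry $1$ in row $j$ and column $i$; let $\theta^j_u(X)=e^j(\lambda_*X)$ be the components of the soldering form, where $(e^j)$ is the coframe dual to $u$. The canonical $n$-tangent structure of $LM$ is $(J^i)_u(X)=\big(\sum_jE^i_j\,\theta^j_u(X)\big)^*(u)$. Let $h$ be an arbitrary smooth positive definite metric tensor field on $M$, put $\hat h_{ij}(u)=h(e_i,e_j)$, and let $J_i=\sum_j\hat h_{ij}J^j$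 be the covariant $n$-tangent structure defined by $h$. **Theorem.** For $u\in LM$, $0\ne\xi\in\mathbb R^n$ and $X\in T_{[u,\xi]}\tilde TM$ put $$\mathcal J([u,\xi])(X)=\frac{\psi_{\xi*}\big(\sum_i\xi^iJ_i(u)(\tilde X)\big)}{\sum_{a,b}\hat h_{ab}(u)\,\xi^a\xi^b},$$ where $\tilde X\in T_uLM$ is any tangent vector with $\lambda_*\tilde X=\tau_*X$. Then: 1. the denominator is never zero, every point of $\tilde TM$ is of the form $[u,\xi]$ with $\xi\neq0$, and such an $\tilde X$ always exists; 2. the right-hand side depends only on the point $[u,\xi]$ and on $X$, not on the choice of $u$, $\xi$ and $\tilde X$, and it is linear in $X$, so that $\mathcal J$ is a well-defined vector-valued $1$-form on $\tilde TM$; 3. $\mathcal J$ is the restriction to $\tilde TM$ of the canonical tangent structure of $TM$, $J_v(Z)=(\tau_{M*}Z)^V_v$, where $\tau_M:TM\to M$ is the projection and $X^V_v=\frac{d}{dt}\big|_{t=0}(v+tX)$ is the vertical lift; and in the coordinates $(x^i,y^i)$ of $\tilde TM$ induced by any chart of $M$, $\mathcal J=\sum_i\frac{\partial}{\partial y^i}\otimes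 dx^i$. -/

import Mathlib

open scoped Manifold ContDiff
open Bundle

noncomputable section

namespace FrameTangent

/-- The standard space `ℝⁿ`. -/
abbrev Vec (n : ℕ) : Type := EuclideanSpace ℝ (Fin n)

/-- The standard basis vector `r̂ᵢ` of `ℝⁿ`. -/
def stdVec {n : ℕ} (i : Fin n) : Vec n := EuclideanSpace.single i 1

section Defs

variable {n : ℕ} {M : Type*} [TopologicalSpace M] [ChartedSpace (Vec n) M]
  [IsManifold (𝓡 n) ∞ M]

/-! ### The linear frame bundle -/

variable (n M) in
/-- The manifold of `n`-tuples of tangent vectors at a common point of `M`, as the total space of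
the smooth vector bundle with fibre `Hom(ℝⁿ, TₓM)`: the tuple `(e₁, …, eₙ)` at `x` is the linear map
with `r̂ᵢ ↦ eᵢ`. -/
abbrev TupleBundle : Type _ :=
  TotalSpace (Vec n →L[ℝ] Vec n)
    (fun x : M => Bundle.Trivial M (Vec n) x →L[ℝ] TangentSpace (𝓡 n) x)

/-- The tuples that are frames form an open set. -/
theorem isOpen_frames :
    IsOpen {u : TupleBundle n M | Function.Bijective u.2} := by
  rw [isOpen_iff_mem_nhds]
  intro u hu
  let t := trivializationAt (Vec n →L[ℝ] Vec n)
    (fun x : M => Bundle.Trivial M (Vec n) x →L[ℝ] TangentSpace (𝓡 n) x) u.1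
  have key : ∀ v : TupleBundle n M, v ∈ t.source →
      (Function.Bijective v.2 ↔ IsUnit (t v).2) := by
    intro v hv
    have hv' : v.1 ∈ (trivializationAt (Vec n) (Bundle.Trivial M (Vec n)) u.1).baseSet ∩
        (trivializationAt (Vec n) (TangentSpace (𝓡 n) : M → Type) u.1).baseSet := hv
    have h1 : (t v).2 = ContinuousLinearMap.inCoordinates (Vec n) (Bundle.Trivial M (Vec n))
        (Vec n) (TangentSpace (𝓡 n) : M → Type) u.1 v.1 u.1 v.1 v.2 := rfl
    rw [h1, ContinuousLinearMap.inCoordinates_eq hv'.1 hv'.2, ContinuousLinearMap.isUnit_iff_bijective]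
    let e₁ := (trivializationAt (Vec n) (Bundle.Trivial M (Vec n)) u.1).continuousLinearEquivAt ℝ
      v.1 hv'.1
    let e₂ := (trivializationAt (Vec n) (TangentSpace (𝓡 n) : M → Type) u.1).continuousLinearEquivAt ℝ
      v.1 hv'.2
    exact ((EquivLike.comp_bijective (v.2 ∘ e₁.symm) e₂).trans
      (EquivLike.bijective_comp e₁.symm v.2)).symm
  have hs : t.source ∈ nhds u := t.open_source.mem_nhds (FiberBundle.mem_trivializationAt_proj_source)
  have hc : ContinuousAt (fun v => (t v).2) u :=
    continuous_snd.continuousAt.comp (t.continuousOn_toFun.continuousAt hs)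
  have hu' := (key u (mem_of_mem_nhds hs)).1 hu
  filter_upwards [hs, hc (Units.isOpen.mem_nhds hu')] with v hv hv2
  exact (key v hv).2 hv2

variable (n M) in
/-- The frames, as an open submanifold of the manifold of all `n`-tuples of tangent vectors. -/
def frames : TopologicalSpace.Opens (TupleBundle n M) :=
  ⟨{u | Function.Bijective u.2}, isOpen_frames⟩

variable (n M) in
/-- The linear frame bundle `LM`. -/
abbrev LM : Type _ := frames n M

/-- The model with corners of `LM`. -/
abbrev modelLM (n : ℕ) := (𝓡 n).prod 𝓘(ℝ, Vec n →L[ℝ] Vec n)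

/-- The projection `λ : LM → M`. -/
def LM.proj (u : LM n M) : M := u.1.1

/-- The linear isomorphism `ℝⁿ → TₓM`, `ξ ↦ ξⁱ eᵢ` given by a frame `u = (x, eᵢ)`. -/
def LM.toEquiv (u : LM n M) : Vec n ≃ₗ[ℝ] TangentSpace (𝓡 n) u.proj :=
  LinearEquiv.ofBijective
    (show Vec n →L[ℝ] TangentSpace (𝓡 n) u.proj from u.1.2).toLinearMap u.2

/-- The vector `eᵢ` of the frame `u = (x, eᵢ)`. -/
def LM.vec (u : LM n M) (i : Fin n) : TangentSpace (𝓡 n) u.proj := u.toEquiv (stdVec i)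

/-- The right action of `GL(n, ℝ)`: `(x, eᵢ) · g = (x, eⱼ gʲᵢ)`. -/
def LM.act (u : LM n M) (g : GL (Fin n) ℝ) : LM n M :=
  ⟨⟨u.1.1, (show Vec n →L[ℝ] TangentSpace (𝓡 n) u.1.1 from u.1.2).comp
      (Matrix.toEuclideanCLM (𝕜 := ℝ) (g : Matrix (Fin n) (Fin n) ℝ))⟩, by
    have hg : Function.Bijective (Matrix.toEuclideanCLM (𝕜 := ℝ) (g : Matrix (Fin n) (Fin n) ℝ)) :=
      ContinuousLinearMap.isUnit_iff_bijective.1 (g.isUnit.map _)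
    exact u.2.comp hg⟩

/-- `exp A` as an element of `GL(n, ℝ)`. -/
def expGL {n : ℕ} (A : Matrix (Fin n) (Fin n) ℝ) : GL (Fin n) ℝ := (Matrix.isUnit_exp A).unit

/-- The fundamental vertical vector field `A*(u) = d/dt (u · exp (t A))` at `t = 0`. -/
def fundamental (A : Matrix (Fin n) (Fin n) ℝ) (u : LM n M) : TangentSpace (modelLM n) u :=
  mfderiv 𝓘(ℝ, ℝ) (modelLM n) (fun t : ℝ => u.act (expGL (t • A))) 0 (1 : ℝ)

/-- The soldering form `θʲ_u(X) = eʲ(λ_* X)`, where `(eʲ)` is the coframe dual to `u`. -/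
def soldering (u : LM n M) (X : TangentSpace (modelLM n) u) (j : Fin n) : ℝ :=
  u.toEquiv.symm (mfderiv (modelLM n) (𝓡 n) LM.proj u X) j

/-- The basis element `Eⁱⱼ` of `gl(n, ℝ)`: the one with `eᵢ · Eⁱⱼ = eⱼ`, that is, with its
entry `1` in row `j` and column `i`. -/
def glBasis {n : ℕ} (i j : Fin n) : Matrix (Fin n) (Fin n) ℝ := Matrix.single j i 1

/-- The canonical `n`-tangent structure on `LM`: `Jⁱ_u(X) = (∑ⱼ θʲ_u(X) Eⁱⱼ)*(u)`. -/
def nTangent (i : Fin n) (u : LM n M) (X : TangentSpace (modelLM n) u) :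
    TangentSpace (modelLM n) u :=
  fundamental (∑ j, soldering u X j • glBasis i j) u

/-! ### The covariant structure based on a metric -/

variable (n M) in
/-- Smooth positive definite metric tensor fields on `M`. -/
abbrev Metric : Type _ :=
  ContMDiffRiemannianMetric (𝓡 n) ∞ (Vec n) (fun x : M => TangentSpace (𝓡 n) x)

/-- The functions `ĥᵢⱼ(u) = h(eᵢ, eⱼ)` on `LM`. -/
def hHat (h : Metric n M) (u : LM n M) (i j : Fin n) : ℝ := h.inner u.proj (u.vec i) (u.vec j)

/-- The covariant `n`-tangent structure `Jᵢ = ∑ⱼ ĥᵢⱼ Jʲ` based on `h`. -/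
def covariantTangent (h : Metric n M) (i : Fin n) (u : LM n M) (X : TangentSpace (modelLM n) u) :
    TangentSpace (modelLM n) u :=
  ∑ j, hHat h u i j • nTangent j u X

/-! ### The tangent bundle as an associated bundle -/

/-- The action of `GL(n, ℝ)` on `ℝⁿ`. -/
def glAct {n : ℕ} (g : GL (Fin n) ℝ) (ξ : Vec n) : Vec n :=
  Matrix.toEuclideanCLM (𝕜 := ℝ) (g : Matrix (Fin n) (Fin n) ℝ) ξ

theorem glAct_one {n : ℕ} (ξ : Vec n) : glAct 1 ξ = ξ := by
  simp [glAct]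

theorem glAct_glAct {n : ℕ} (g k : GL (Fin n) ℝ) (ξ : Vec n) :
    glAct g (glAct k ξ) = glAct (g * k) ξ := by
  simp [glAct, map_mul]

theorem act_one (u : LM n M) : u.act 1 = u := by
  apply Subtype.ext
  simp only [LM.act, Units.val_one, map_one]
  rfl

theorem act_act (u : LM n M) (g k : GL (Fin n) ℝ) : (u.act g).act k = u.act (g * k) := by
  apply Subtype.ext
  simp only [LM.act, Units.val_mul, map_mul]
  rfl

theorem toEquiv_act (u : LM n M) (g : GL (Fin n) ℝ) (ξ : Vec n) :
    (u.act g).toEquiv ξ = u.toEquiv (glAct g ξ) := rfl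

variable (n M) in
/-- The equivalence relation `(u, ξ) ∼ (u · g, g⁻¹ ξ)` on `LM × ℝⁿ`. -/
def assocSetoid : Setoid (LM n M × Vec n) where
  r a b := ∃ g : GL (Fin n) ℝ, b = (a.1.act g, glAct g⁻¹ a.2)
  iseqv := by
    refine ⟨fun a => ⟨1, ?_⟩, ?_, ?_⟩
    · simp [act_one, glAct_one]
    · rintro a b ⟨g, rfl⟩
      exact ⟨g⁻¹, by simp [act_act, act_one, glAct_glAct, glAct_one]⟩
    · rintro a b c ⟨g, rfl⟩ ⟨k, rfl⟩
      exact ⟨g * k, by simp [act_act, glAct_glAct]⟩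

variable (n M) in
/-- The bundle `LM ×_{GL(n)} ℝⁿ` associated to `LM` and the standard action. -/
abbrev Assoc : Type _ := Quotient (assocSetoid n M)

/-- The identification of the associated bundle with `TM`: `[(x, eᵢ), ξ] ↦ ξⁱ eᵢ ∈ TₓM`. -/
def Assoc.toTangent : Assoc n M → TangentBundle (𝓡 n) M :=
  Quotient.lift (fun a : LM n M × Vec n => ⟨a.1.proj, a.1.toEquiv a.2⟩) (by
    rintro ⟨u, ξ⟩ _ ⟨g, rfl⟩
    have h1 : (u.act g).toEquiv (glAct g⁻¹ ξ) = u.toEquiv ξ := by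
      rw [toEquiv_act, glAct_glAct, mul_inv_cancel, glAct_one]
    exact congrArg (fun w => (⟨u.proj, w⟩ : TangentBundle (𝓡 n) M)) h1.symm)

theorem Assoc.toTangent_bijective :
    Function.Bijective (Assoc.toTangent : Assoc n M → TangentBundle (𝓡 n) M) := by
  constructor
  · rintro ⟨⟨⟨x, a⟩, ha⟩, ξ⟩ ⟨⟨⟨y, b⟩, hb⟩, η⟩ h
    obtain rfl : x = y := congrArg TotalSpace.proj h
    have h2 : a ξ = b η := by
      injection h with _ h2
    let u : LM n M := ⟨⟨x, a⟩, ha⟩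
    let w : LM n M := ⟨⟨x, b⟩, hb⟩
    let c : Vec n ≃ₗ[ℝ] Vec n := w.toEquiv.trans u.toEquiv.symm
    have hc : ∀ v, a (c v) = b v := fun v => u.toEquiv.apply_symm_apply (w.toEquiv v)
    let A : Matrix (Fin n) (Fin n) ℝ :=
      (Matrix.toEuclideanCLM (𝕜 := ℝ)).symm (LinearMap.toContinuousLinearMap (c : Vec n →ₗ[ℝ] Vec n))
    have hA : Matrix.toEuclideanCLM (𝕜 := ℝ) A =
        LinearMap.toContinuousLinearMap (c : Vec n →ₗ[ℝ] Vec n) :=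
      (Matrix.toEuclideanCLM (𝕜 := ℝ)).apply_symm_apply _
    have hAu : IsUnit A := by
      have hbij : IsUnit (LinearMap.toContinuousLinearMap (c : Vec n →ₗ[ℝ] Vec n)) :=
        ContinuousLinearMap.isUnit_iff_bijective.2 c.bijective
      exact hbij.map (Matrix.toEuclideanCLM (n := Fin n) (𝕜 := ℝ)).symm
    have hg : ∀ v, glAct hAu.unit v = c v := fun v => DFunLike.congr_fun hA v
    refine Quotient.sound ⟨hAu.unit, Prod.ext ?_ ?_⟩
    · apply Subtype.ext
      refine congrArg (fun l => (⟨x, l⟩ : TupleBundle n M)) ?_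
      refine ContinuousLinearMap.ext fun v => ?_
      exact (hc v).symm.trans (congrArg a (hg v).symm)
    · have h3 : glAct hAu.unit η = ξ := ha.1 ((congrArg a (hg η)).trans ((hc η).trans h2.symm))
      change η = glAct hAu.unit⁻¹ ξ
      rw [← h3, glAct_glAct, inv_mul_cancel, glAct_one]
  · rintro ⟨x, v⟩
    exact ⟨Quotient.mk _ (⟨⟨x, ContinuousLinearMap.id ℝ (Vec n)⟩, Function.bijective_id⟩, v), rfl⟩

/-- The vectors away from the zero section form an open set. -/
theorem isOpen_slit : IsOpen {v : TangentBundle (𝓡 n) M | v.2 ≠ 0} := by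
  rw [isOpen_iff_mem_nhds]
  intro u hu
  let t := trivializationAt (Vec n) (TangentSpace (𝓡 n) : M → Type) u.1
  have key : ∀ v : TangentBundle (𝓡 n) M, v ∈ t.source → (v.2 ≠ 0 ↔ (t v).2 ≠ 0) := by
    intro v hv
    have hv' : v.1 ∈ t.baseSet := t.mem_source.1 hv
    have h1 : (t v).2 = t.continuousLinearEquivAt ℝ v.1 hv' v.2 := rfl
    rw [h1, Ne, Ne, EmbeddingLike.map_eq_zero_iff]
  have hs : t.source ∈ nhds u := t.open_source.mem_nhds (FiberBundle.mem_trivializationAt_proj_source)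
  have hc : ContinuousAt (fun v => (t v).2) u :=
    continuous_snd.continuousAt.comp (t.continuousOn_toFun.continuousAt hs)
  have hu' := (key u (mem_of_mem_nhds hs)).1 hu
  filter_upwards [hs, hc (isOpen_ne.mem_nhds hu')] with v hv hv2
  exact (key v hv).2 hv2

variable (n M) in
/-- The complement of the zero section in `TM`. -/
def slit : TopologicalSpace.Opens (TangentBundle (𝓡 n) M) := ⟨{v | v.2 ≠ 0}, isOpen_slit⟩

variable (n M) in
/-- The manifold `T̃M`: the tangent bundle without its zero section, an open submanifold of `TM`. -/
abbrev SlitTM : Type _ := slit n M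

/-- The map `ψ_ξ : LM → T̃M`, `u ↦ [u, ξ]`, for `ξ ≠ 0`. -/
def psi (ξ : Vec n) (hξ : ξ ≠ 0) (u : LM n M) : SlitTM n M :=
  ⟨Assoc.toTangent (Quotient.mk (assocSetoid n M) (u, ξ)),
    fun h0 => hξ ((LinearEquiv.map_eq_zero_iff u.toEquiv).1 h0)⟩

/-- The projection `τ : T̃M → M`. -/
def SlitTM.proj (p : SlitTM n M) : M := p.1.1

/-! ### The canonical tangent structure -/

/-- The vertical lift `X^V(v) = d/dt (v + t X)` at `t = 0`, for `v, X ∈ TₓM`. -/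
def verticalLift (v : TangentBundle (𝓡 n) M) (X : TangentSpace (𝓡 n) v.1) :
    TangentSpace (𝓡 n).tangent v :=
  mfderiv 𝓘(ℝ, ℝ) (𝓡 n).tangent
    (fun t : ℝ => (⟨v.1, v.2 + t • X⟩ : TangentBundle (𝓡 n) M)) 0 (1 : ℝ)

/-- The canonical tangent structure on `TM`: `J_v(Z) = (τ_* Z)^V(v)`. -/
def canonicalTangent (v : TangentBundle (𝓡 n) M) (Z : TangentSpace (𝓡 n).tangent v) :
    TangentSpace (𝓡 n).tangent v :=
  verticalLift v
    (mfderiv (𝓡 n).tangent (𝓡 n) (fun w : TangentBundle (𝓡 n) M => w.1) v Z)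

/-- The coordinates `(x, y)` on `T̃M` induced by a chart `e` of `M`:
`xⁱ(v) = eⁱ(τ(v))` and `yⁱ(v) = v(eⁱ)`. They are meaningful over the domain of `e`. -/
def bundleCoord (e : OpenPartialHomeomorph M (Vec n)) (p : SlitTM n M) : Vec n × Vec n :=
  (e p.proj, mfderiv (𝓡 n) 𝓘(ℝ, Vec n) e p.proj p.1.2)

/-- The coordinate differential `dxⁱ` on `T̃M`. -/
def dx (e : OpenPartialHomeomorph M (Vec n)) (i : Fin n) (p : SlitTM n M)
    (X : TangentSpace (𝓡 n).tangent p) : ℝ :=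
  mfderiv (𝓡 n).tangent 𝓘(ℝ, ℝ) (fun q : SlitTM n M => (bundleCoord e q).1 i) p X

/-- The coordinate vector field `∂/∂yⁱ` on `T̃M`: the tangent vector whose components in the
coordinates `(x, y)` are `(0, r̂ᵢ)`. -/
def partialY (e : OpenPartialHomeomorph M (Vec n)) (i : Fin n) (p : SlitTM n M) :
    TangentSpace (𝓡 n).tangent p :=
  (mfderiv (𝓡 n).tangent 𝓘(ℝ, Vec n × Vec n) (bundleCoord e) p).inverse
    ((0, stdVec i) : Vec n × Vec n)

end Defs

end FrameTangent

end

open Filter Topology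

namespace FrameTangent

/-! A tangent space in Mathlib is the model space, read through the preferred chart at the point.
Bundle charts come from the trivialization at the base point, so at that point every map involved
has an elementary differential: `λ_*` and `τ_*` are `(a, b) ↦ a`, `ψ_ξ*` is `(a, B) ↦ (a, B ξ)`, and
`A*(u) = (0, u ∘ A)`.

The matrix `∑ⱼ θʲ Eⁱⱼ` sends `ξ` to `ξⁱ θ`, and `u` sends `θ_u(X)` back to `λ_* X`. Hence `ψ_ξ*(Jⁱ
X) = (0, ξⁱ λ_* X)`. Contracting with `ĥᵢⱼ ξⁱ` produces the factor `∑ ĥᵢⱼ ξⁱ ξʲ`, which is `h(u ξ, u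
ξ) > 0` and is exactly the denominator. What remains is `(0, τ_* X)`, the map `shear`, in which `u`,
`ξ`, the lift and `h` no longer occur (`shear_psi_eq`). The canonical tangent structure has the same
form (`canonicalTangent_eq`).

For an arbitrary chart `e` with differential `A`, the coordinates `(x, y)` have a block triangular
differential with both diagonal blocks equal to `A`. It is therefore invertible and maps `(0, a)` to
`(0, A a)`, which is the coordinate formula (`shear_eq_sum_partialY`). -/

/-! ### Differentials read off in preferred charts, and open submanifolds. -/

/-- The source of all the explicit differentials below. Hypothesis `hs` serves continuity: it allows
`f` to be recovered from its chart expression `φ`. -/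
theorem hasMFDerivAt_of_extChartAt_eventuallyEq {E E' H H' M M' : Type*}
    [NormedAddCommGroup E] [NormedSpace ℝ E] [NormedAddCommGroup E'] [NormedSpace ℝ E']
    [TopologicalSpace H] [TopologicalSpace H'] {I : ModelWithCorners ℝ E H}
    {I' : ModelWithCorners ℝ E' H'} [TopologicalSpace M] [ChartedSpace H M]
    [TopologicalSpace M'] [ChartedSpace H' M'] {f : M → M'} {x : M} {φ : E → E'} {φ' : E →L[ℝ] E'}
    (hφ : HasFDerivAt φ φ' (extChartAt I x x))
    (hs : ∀ᶠ y in 𝓝 x, f y ∈ (extChartAt I' (f x)).source)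
    (h : ∀ᶠ y in 𝓝 x, extChartAt I' (f x) (f y) = φ (extChartAt I x y)) :
    HasMFDerivAt I I' f x φ' := by
  constructor
  · have h1 : ContinuousAt (fun y => (extChartAt I' (f x)).symm (φ (extChartAt I x y))) x := by
      have h2 : φ (extChartAt I x x) = extChartAt I' (f x) (f x) := h.self_of_nhds.symm
      refine ContinuousAt.comp (f := fun y => φ (extChartAt I x y)) (x := x) ?_ ?_
      · simp only [h2]
        exact continuousAt_extChartAt_symm (f x)
      · exact ContinuousAt.comp hφ.continuousAt (continuousAt_extChartAt x)
    refine h1.congr ?_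
    filter_upwards [hs, h] with y hy hy'
    rw [← hy', (extChartAt I' (f x)).left_inv hy]
  · refine hφ.hasFDerivWithinAt.congr_of_eventuallyEq ?_ ?_
    · have h3 := (continuousAt_extChartAt_symm (I := I) x).tendsto
      rw [extChartAt_to_inv] at h3
      have h4 := (h3.eventually h).filter_mono (nhdsWithin_le_nhds (s := Set.range I))
      filter_upwards [h4, extChartAt_target_mem_nhdsWithin (I := I) x] with z hz hz'
      simp only [writtenInExtChartAt, Function.comp]
      rw [hz, (extChartAt I x).right_inv hz']
    · simp only [writtenInExtChartAt, Function.comp, extChartAt_to_inv]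
      exact h.self_of_nhds

theorem hasMFDerivAt_subtype_val {E H M : Type*}
    [NormedAddCommGroup E] [NormedSpace ℝ E] [TopologicalSpace H] {I : ModelWithCorners ℝ E H}
    [TopologicalSpace M] [ChartedSpace H M] {U : TopologicalSpace.Opens M} (x : U) :
    HasMFDerivAt I I (Subtype.val : U → M) x (ContinuousLinearMap.id ℝ E) :=
  hasMFDerivAt_of_extChartAt_eventuallyEq (φ := id) (hasFDerivAt_id _)
    (continuousAt_subtype_val (extChartAt_source_mem_nhds _)) (Eventually.of_forall fun _ => rfl)

/-- Charts of an open submanifold are restrictions of ambient charts, so the chart expression is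
unchanged; only continuity has to be transferred. -/
theorem HasMFDerivAt.codRestrict_opens {E E' H H' M M' : Type*}
    [NormedAddCommGroup E] [NormedSpace ℝ E] [NormedAddCommGroup E'] [NormedSpace ℝ E']
    [TopologicalSpace H] [TopologicalSpace H'] {I : ModelWithCorners ℝ E H}
    {I' : ModelWithCorners ℝ E' H'} [TopologicalSpace M] [ChartedSpace H M]
    [TopologicalSpace M'] [ChartedSpace H' M'] {U : TopologicalSpace.Opens M'} {f : M → U} {x : M}
    {f' : E →L[ℝ] E'} (hf : HasMFDerivAt I I' (fun y => (f y : M')) x f') :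
    HasMFDerivAt I I' f x f' :=
  ⟨Topology.IsInducing.subtypeVal.continuousAt_iff.2 hf.1, hf.2⟩

/-! ### Projection and fibre curves in a fibre bundle. -/

section Proj

variable {F B : Type*} {E : B → Type*} [NormedAddCommGroup F] [NormedSpace ℝ F]
  [TopologicalSpace (TotalSpace F E)] [∀ x, TopologicalSpace (E x)] {EB HB : Type*}
  [NormedAddCommGroup EB] [NormedSpace ℝ EB] [TopologicalSpace HB]
  {IB : ModelWithCorners ℝ EB HB} [TopologicalSpace B] [ChartedSpace HB B] [FiberBundle F E]

theorem extChartAt_totalSpace_apply (x : TotalSpace F E) {y : TotalSpace F E}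
    (hy : y.1 ∈ (trivializationAt F E x.1).baseSet) :
    extChartAt (IB.prod 𝓘(ℝ, F)) x y = (extChartAt IB x.1 y.1, (trivializationAt F E x.1 y).2) := by
  rw [FiberBundle.extChartAt]
  exact Prod.ext (congrArg (extChartAt IB x.1) ((trivializationAt F E x.1).coe_fst' hy)) rfl

theorem mem_extChartAt_totalSpace_source (x y : TotalSpace F E) :
    y ∈ (extChartAt (IB.prod 𝓘(ℝ, F)) x).source ↔
      y.1 ∈ (trivializationAt F E x.1).baseSet ∧ y.1 ∈ (extChartAt IB x.1).source := by
  rw [FiberBundle.extChartAt]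
  constructor
  · intro h
    have h1 := (trivializationAt F E x.1).mem_source.1 h.1
    refine ⟨h1, ?_⟩
    have h2 := h.2.1
    simpa [(trivializationAt F E x.1).coe_fst' h1] using h2
  · intro h
    refine ⟨(trivializationAt F E x.1).mem_source.2 h.1, ?_, trivial⟩
    simpa [(trivializationAt F E x.1).coe_fst' h.1] using h.2

variable (IB) in
theorem eventually_mem_baseSet_source (x : TotalSpace F E) :
    ∀ᶠ y : TotalSpace F E in 𝓝 x, y.1 ∈ (trivializationAt F E x.1).baseSet ∧
      y.1 ∈ (extChartAt IB x.1).source := by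
  filter_upwards [extChartAt_source_mem_nhds (I := IB.prod 𝓘(ℝ, F)) x] with y hy
  exact (mem_extChartAt_totalSpace_source x y).1 hy

theorem hasMFDerivAt_totalSpace_proj (x : TotalSpace F E) :
    HasMFDerivAt (IB.prod 𝓘(ℝ, F)) IB (TotalSpace.proj : TotalSpace F E → B) x
      (ContinuousLinearMap.fst ℝ EB F) := by
  refine hasMFDerivAt_of_extChartAt_eventuallyEq (φ := Prod.fst) hasFDerivAt_fst ?_ ?_
  · exact (eventually_mem_baseSet_source IB x).mono fun _ h => h.2
  · exact (eventually_mem_baseSet_source IB x).mono fun _ h => by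
      rw [extChartAt_totalSpace_apply x h.1]

/-- The bundle chart at `⟨b, c t⟩` uses a trivialization that depends on `b` alone, so a single
trivialization serves the whole curve. Both vertical lifts and fundamental fields are instances. -/
theorem hasMFDerivAt_fiber_curve {b : B} {c : ℝ → E b} {t : ℝ} {d : F}
    (hc : HasDerivAt (fun s => (trivializationAt F E b ⟨b, c s⟩).2) d t) :
    HasMFDerivAt 𝓘(ℝ, ℝ) (IB.prod 𝓘(ℝ, F)) (fun s => (⟨b, c s⟩ : TotalSpace F E)) t
      (ContinuousLinearMap.toSpanSingleton ℝ ((0, d) : EB × F)) := by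
  have hb := FiberBundle.mem_baseSet_trivializationAt' (F := F) (E := E) b
  refine hasMFDerivAt_of_extChartAt_eventuallyEq
    (φ := fun s => (extChartAt IB b b, (trivializationAt F E b ⟨b, c s⟩).2)) ?_
    (Eventually.of_forall fun s => ?_) (Eventually.of_forall fun s => ?_)
  · exact ((hasDerivAt_const t (extChartAt IB b b)).prodMk hc).hasFDerivAt
  · exact (mem_extChartAt_totalSpace_source _ _).2 ⟨hb, mem_extChartAt_source b⟩
  · exact extChartAt_totalSpace_apply (⟨b, c t⟩ : TotalSpace F E) hb

end Proj

/-! ### Model forms of the differentials on `LM`, `TM` and the slit bundle. -/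

section LocalForms

variable {n : ℕ} {M : Type*} [TopologicalSpace M] [ChartedSpace (Vec n) M]
  [IsManifold (𝓡 n) ∞ M]

/-- The coordinate change from the preferred chart to itself is the identity; hence no Jacobian
enters the vertical components. -/
theorem trivializationAt_tangent_self (x : M) (v : TangentSpace (𝓡 n) x) :
    (trivializationAt (Vec n) (TangentSpace (𝓡 n) : M → Type) x ⟨x, v⟩).2 = v :=
  tangentCoordChange_self (I := 𝓡 n) (mem_extChartAt_source x)

/-- Trivializing a tuple is post-composition with the tangent trivialization, because the domain
bundle is trivial. Evaluation at `ξ` thus commutes with trivializing, which makes `ψ_ξ` linear on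
fibres in charts. -/
theorem trivializationAt_tuple_snd (x y : M)
    (hy : y ∈ (trivializationAt (Vec n) (TangentSpace (𝓡 n) : M → Type) x).baseSet)
    (A : Vec n →L[ℝ] TangentSpace (𝓡 n) y) (ξ : Vec n) :
    (trivializationAt (Vec n →L[ℝ] Vec n)
      (fun x : M => Bundle.Trivial M (Vec n) x →L[ℝ] TangentSpace (𝓡 n) x) x
        (⟨y, A⟩ : TupleBundle n M)).2 ξ =
      (trivializationAt (Vec n) (TangentSpace (𝓡 n) : M → Type) x ⟨y, A ξ⟩).2 := by
  have h1 : (trivializationAt (Vec n →L[ℝ] Vec n)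
      (fun x : M => Bundle.Trivial M (Vec n) x →L[ℝ] TangentSpace (𝓡 n) x) x
        (⟨y, A⟩ : TupleBundle n M)).2 =
      ContinuousLinearMap.inCoordinates (Vec n) (Bundle.Trivial M (Vec n))
        (Vec n) (TangentSpace (𝓡 n) : M → Type) x y x y A := rfl
  rw [h1, ContinuousLinearMap.inCoordinates_eq (Set.mem_univ y) hy]
  have h2 : ∀ w : Vec n, ((trivializationAt (Vec n) (Bundle.Trivial M (Vec n)) x).continuousLinearEquivAt
      ℝ y (Set.mem_univ y)).symm w = w := fun w => by
    rw [ContinuousLinearEquiv.symm_apply_eq]; rfl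
  exact congrArg (fun w => (trivializationAt (Vec n) (TangentSpace (𝓡 n) : M → Type) x
    ⟨y, A w⟩).2) (h2 ξ)

theorem trivializationAt_tuple_self (x : M) (A : Vec n →L[ℝ] TangentSpace (𝓡 n) x) :
    (trivializationAt (Vec n →L[ℝ] Vec n)
      (fun x : M => Bundle.Trivial M (Vec n) x →L[ℝ] TangentSpace (𝓡 n) x) x
        (⟨x, A⟩ : TupleBundle n M)).2 = (A : Vec n →L[ℝ] Vec n) :=
  ContinuousLinearMap.ext fun ξ => (trivializationAt_tuple_snd x x
    (FiberBundle.mem_baseSet_trivializationAt' x) A ξ).trans (trivializationAt_tangent_self x (A ξ))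

theorem mfderiv_LM_proj (u : LM n M) :
    mfderiv (modelLM n) (𝓡 n) LM.proj u =
      ContinuousLinearMap.fst ℝ (Vec n) (Vec n →L[ℝ] Vec n) :=
  ((hasMFDerivAt_totalSpace_proj u.1).comp u (hasMFDerivAt_subtype_val u)).mfderiv

theorem mfderiv_slit_val (p : SlitTM n M) :
    mfderiv (𝓡 n).tangent (𝓡 n).tangent (Subtype.val : SlitTM n M → TangentBundle (𝓡 n) M) p =
      ContinuousLinearMap.id ℝ (Vec n × Vec n) :=
  (hasMFDerivAt_subtype_val p).mfderiv

theorem mfderiv_tangent_proj (v : TangentBundle (𝓡 n) M) :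
    mfderiv (𝓡 n).tangent (𝓡 n) (fun w : TangentBundle (𝓡 n) M => w.1) v =
      ContinuousLinearMap.fst ℝ (Vec n) (Vec n) :=
  (hasMFDerivAt_totalSpace_proj v).mfderiv

theorem hasMFDerivAt_slit_proj (p : SlitTM n M) :
    HasMFDerivAt (𝓡 n).tangent (𝓡 n) SlitTM.proj p (ContinuousLinearMap.fst ℝ (Vec n) (Vec n)) :=
  (hasMFDerivAt_totalSpace_proj p.1).comp p (hasMFDerivAt_subtype_val p)

theorem hasMFDerivAt_tuple_eval (ξ : Vec n) (u : TupleBundle n M) :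
    HasMFDerivAt (modelLM n) (𝓡 n).tangent
      (fun w : TupleBundle n M => (⟨w.1, w.2 ξ⟩ : TangentBundle (𝓡 n) M)) u
      ((ContinuousLinearMap.id ℝ (Vec n)).prodMap (ContinuousLinearMap.apply ℝ (Vec n) ξ)) := by
  refine hasMFDerivAt_of_extChartAt_eventuallyEq (φ := fun z => (z.1, z.2 ξ))
    ((ContinuousLinearMap.id ℝ (Vec n)).prodMap
      (ContinuousLinearMap.apply ℝ (Vec n) ξ)).hasFDerivAt ?_ ?_
  · filter_upwards [eventually_mem_baseSet_source (𝓡 n) u] with y hy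
    exact (mem_extChartAt_totalSpace_source _ _).2 ⟨hy.1.2, hy.2⟩
  · filter_upwards [eventually_mem_baseSet_source (𝓡 n) u] with y hy
    refine (extChartAt_totalSpace_apply (IB := 𝓡 n) (⟨u.1, u.2 ξ⟩ : TangentBundle (𝓡 n) M)
      (y := ⟨y.1, y.2 ξ⟩) hy.1.2).trans ?_
    rw [extChartAt_totalSpace_apply (IB := 𝓡 n) u hy.1]
    exact Prod.ext rfl (trivializationAt_tuple_snd u.1 y.1 hy.1.2 y.2 ξ).symm

theorem mfderiv_psi (ξ : Vec n) (hξ : ξ ≠ 0) (u : LM n M) :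
    mfderiv (modelLM n) (𝓡 n).tangent (psi ξ hξ) u =
      (ContinuousLinearMap.id ℝ (Vec n)).prodMap (ContinuousLinearMap.apply ℝ (Vec n) ξ) :=
  (HasMFDerivAt.codRestrict_opens
    ((hasMFDerivAt_tuple_eval ξ u.1).comp u (hasMFDerivAt_subtype_val u))).mfderiv

theorem hasMFDerivAt_vertical_curve (v : TangentBundle (𝓡 n) M) (X : TangentSpace (𝓡 n) v.1) :
    HasMFDerivAt 𝓘(ℝ, ℝ) (𝓡 n).tangent
      (fun t : ℝ => (⟨v.1, v.2 + t • X⟩ : TangentBundle (𝓡 n) M)) 0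
      (ContinuousLinearMap.toSpanSingleton ℝ ((0, X) : Vec n × Vec n)) := by
  refine hasMFDerivAt_fiber_curve (c := fun t : ℝ => v.2 + t • X) ?_
  have h := ((hasDerivAt_id (0:ℝ)).smul_const (show Vec n from X)).const_add (show Vec n from v.2)
  rw [one_smul] at h
  exact h.congr_deriv rfl |>.congr_of_eventuallyEq
    (Eventually.of_forall fun t => trivializationAt_tangent_self v.1 (v.2 + t • X))

theorem verticalLift_eq (v : TangentBundle (𝓡 n) M) (X : TangentSpace (𝓡 n) v.1) :
    verticalLift v X = ((0, X) : Vec n × Vec n) := by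
  have h := (hasMFDerivAt_vertical_curve v X).mfderiv
  refine (DFunLike.congr_fun h (1 : ℝ)).trans ?_
  exact one_smul ℝ ((0, X) : Vec n × Vec n)

theorem canonicalTangent_eq (v : TangentBundle (𝓡 n) M) (Z : TangentSpace (𝓡 n).tangent v) :
    canonicalTangent v Z = ((0, (show Vec n × Vec n from Z).1) : Vec n × Vec n) := by
  rw [canonicalTangent, verticalLift_eq, mfderiv_tangent_proj]
  rfl

-- The matrix norm is needed only to differentiate the exponential; `L` is continuous by finite
-- dimension.
open scoped Matrix.Norms.Operator in
theorem hasDerivAt_toEuclideanCLM_exp (A : Matrix (Fin n) (Fin n) ℝ) :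
    HasDerivAt (fun t : ℝ => Matrix.toEuclideanCLM (𝕜 := ℝ) (NormedSpace.exp (t • A)))
      (Matrix.toEuclideanCLM (𝕜 := ℝ) A) 0 := by
  have h := hasDerivAt_exp_smul_const (𝕂 := ℝ) A (0 : ℝ)
  simp only [zero_smul, NormedSpace.exp_zero, one_mul] at h
  let L : Matrix (Fin n) (Fin n) ℝ →L[ℝ] (Vec n →L[ℝ] Vec n) :=
    LinearMap.toContinuousLinearMap
      (Matrix.toEuclideanCLM (n := Fin n) (𝕜 := ℝ)).toAlgEquiv.toLinearMap
  exact L.hasFDerivAt.comp_hasDerivAt (0 : ℝ) h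

theorem fundamental_eq (A : Matrix (Fin n) (Fin n) ℝ) (u : LM n M) :
    fundamental A u = ((0, (show Vec n →L[ℝ] Vec n from u.1.2).comp
      (Matrix.toEuclideanCLM (𝕜 := ℝ) A)) : Vec n × (Vec n →L[ℝ] Vec n)) := by
  have hd : HasDerivAt (fun t : ℝ => (show Vec n →L[ℝ] Vec n from u.1.2).comp
      (Matrix.toEuclideanCLM (𝕜 := ℝ) (NormedSpace.exp (t • A))))
      ((show Vec n →L[ℝ] Vec n from u.1.2).comp (Matrix.toEuclideanCLM (𝕜 := ℝ) A)) 0 :=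
    (ContinuousLinearMap.compL ℝ (Vec n) (Vec n) (Vec n)
      (show Vec n →L[ℝ] Vec n from u.1.2)).hasFDerivAt.comp_hasDerivAt (0 : ℝ)
        (hasDerivAt_toEuclideanCLM_exp A)
  have hm : HasMFDerivAt 𝓘(ℝ, ℝ) (modelLM n) (fun t : ℝ => u.act (expGL (t • A))) 0
      (ContinuousLinearMap.toSpanSingleton ℝ ((0, (show Vec n →L[ℝ] Vec n from u.1.2).comp
        (Matrix.toEuclideanCLM (𝕜 := ℝ) A)) : Vec n × (Vec n →L[ℝ] Vec n))) :=
    HasMFDerivAt.codRestrict_opens (hasMFDerivAt_fiber_curve (IB := 𝓡 n)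
      (hd.congr_of_eventuallyEq
        (Eventually.of_forall fun t => trivializationAt_tuple_self u.1.1 _)))
  exact (DFunLike.congr_fun hm.mfderiv (1 : ℝ)).trans (one_smul ℝ _)


/-! ### The denominator, and the push-forward of the `n`-tangent structure. -/

theorem sum_smul_stdVec (ξ : Vec n) : ∑ i, ξ i • stdVec i = ξ := by
  ext j
  simp [stdVec, Pi.single_apply]

theorem sum_hHat_eq_inner (h : Metric n M) (u : LM n M) (ξ : Vec n) :
    ∑ a, ∑ b, hHat h u a b * ξ a * ξ b = h.inner u.proj (u.toEquiv ξ) (u.toEquiv ξ) := by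
  have hξ : u.toEquiv ξ = ∑ i, ξ i • u.vec i := by
    conv_lhs => rw [← sum_smul_stdVec ξ]
    simp only [map_sum, map_smul, LM.vec]
  rw [hξ]
  simp only [map_sum, map_smul, _root_.sum_apply, _root_.smul_apply,
    smul_eq_mul, hHat, Finset.mul_sum]
  rw [Finset.sum_comm]
  refine Finset.sum_congr rfl fun a _ => Finset.sum_congr rfl fun b _ => ?_
  ring

theorem sum_hHat_ne_zero (h : Metric n M) (u : LM n M) {ξ : Vec n} (hξ : ξ ≠ 0) :
    ∑ a, ∑ b, hHat h u a b * ξ a * ξ b ≠ 0 := by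
  rw [sum_hHat_eq_inner]
  exact (h.pos _ _ fun h0 => hξ ((LinearEquiv.map_eq_zero_iff u.toEquiv).1 h0)).ne'

/-- The matrix has `θ` as column `j` and zeros elsewhere. -/
theorem toEuclideanCLM_sum_glBasis (j : Fin n) (θ ξ : Vec n) :
    Matrix.toEuclideanCLM (𝕜 := ℝ) (∑ k, θ k • glBasis j k) ξ = ξ j • θ := by
  ext i
  simp [glBasis, Matrix.ofLp_toEuclideanCLM, Matrix.mulVec, dotProduct,
    Matrix.single_apply, mul_comm, ite_and]

theorem mfderiv_psi_nTangent (ξ : Vec n) (hξ : ξ ≠ 0) (u : LM n M) (j : Fin n)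
    (X : TangentSpace (modelLM n) u) :
    mfderiv (modelLM n) (𝓡 n).tangent (psi ξ hξ) u (nTangent j u X) =
      ((0, ξ j • (show Vec n × (Vec n →L[ℝ] Vec n) from X).1) : Vec n × Vec n) := by
  rw [nTangent, fundamental_eq, mfderiv_psi]
  refine Prod.ext rfl ?_
  have h1 := toEuclideanCLM_sum_glBasis j (u.toEquiv.symm (mfderiv (modelLM n) (𝓡 n) LM.proj u X)) ξ
  -- The soldering form is `u⁻¹ ∘ λ_*`, so applying `u` cancels the frame.
  refine (congrArg u.toEquiv h1).trans ?_
  rw [map_smul, LinearEquiv.apply_symm_apply, mfderiv_LM_proj]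
  rfl

theorem map_sum_smul_sum_smul {ι V W : Type*} [Fintype ι] [AddCommGroup V] [Module ℝ V]
    [AddCommGroup W] [Module ℝ W] (L : V →ₗ[ℝ] W) (N : ι → V) (ξ : ι → ℝ) (H : ι → ι → ℝ) (w : W)
    (hL : ∀ j, L (N j) = ξ j • w) :
    L (∑ i, ξ i • ∑ j, H i j • N j) = (∑ i, ∑ j, H i j * ξ i * ξ j) • w := by
  simp only [map_sum, map_smul, hL, Finset.smul_sum, Finset.sum_smul, smul_smul]
  refine Finset.sum_congr rfl fun a _ => Finset.sum_congr rfl fun b _ => ?_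
  congr 1
  ring

theorem mfderiv_psi_sum_covariantTangent (h : Metric n M) (ξ : Vec n) (hξ : ξ ≠ 0) (u : LM n M)
    (X : TangentSpace (modelLM n) u) :
    mfderiv (modelLM n) (𝓡 n).tangent (psi ξ hξ) u (∑ i, ξ i • covariantTangent h i u X) =
      (∑ a, ∑ b, hHat h u a b * ξ a * ξ b) •
        ((0, (show Vec n × (Vec n →L[ℝ] Vec n) from X).1) : Vec n × Vec n) := by
  refine map_sum_smul_sum_smul (V := Vec n × (Vec n →L[ℝ] Vec n)) (W := Vec n × Vec n)
    (show Vec n × (Vec n →L[ℝ] Vec n) →L[ℝ] Vec n × Vec n from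
      mfderiv (modelLM n) (𝓡 n).tangent (psi ξ hξ) u).toLinearMap
    (fun j => nTangent j u X) ξ (hHat h u) _ fun j => ?_
  refine (mfderiv_psi_nTangent ξ hξ u j X).trans ?_
  rw [Prod.smul_mk, smul_zero]

/-- Each tangent space is a copy of `ℝⁿ`, so the identity map is a frame in which `ξ` is the vector
itself. -/
theorem exists_psi_eq (p : SlitTM n M) :
    ∃ (u : LM n M) (ξ : Vec n) (hξ : ξ ≠ 0), psi ξ hξ u = p :=
  ⟨⟨⟨p.1.1, ContinuousLinearMap.id ℝ (Vec n)⟩, Function.bijective_id⟩, p.1.2, p.2, rfl⟩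

theorem exists_lift (u : LM n M) (ξ : Vec n) (hξ : ξ ≠ 0)
    (X : TangentSpace (𝓡 n).tangent (psi ξ hξ u)) :
    ∃ X' : TangentSpace (modelLM n) u,
      (mfderiv (modelLM n) (𝓡 n) LM.proj u X' : TangentSpace (𝓡 n) u.proj) =
        mfderiv (𝓡 n).tangent (𝓡 n) SlitTM.proj (psi ξ hξ u) X := by
  refine ⟨(((show Vec n × Vec n from X).1, 0) : Vec n × (Vec n →L[ℝ] Vec n)), ?_⟩
  rw [mfderiv_LM_proj, (hasMFDerivAt_slit_proj _).mfderiv]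
  rfl

variable (n) in
/-- The endomorphism `(a, b) ↦ (0, a)` of `ℝⁿ × ℝⁿ`. -/
noncomputable def shear : Vec n × Vec n →L[ℝ] Vec n × Vec n :=
  (ContinuousLinearMap.inr ℝ (Vec n) (Vec n)).comp (ContinuousLinearMap.fst ℝ (Vec n) (Vec n))

theorem shear_psi_eq (h : Metric n M) (u : LM n M) (ξ : Vec n) (hξ : ξ ≠ 0)
    (X : TangentSpace (𝓡 n).tangent (psi ξ hξ u)) (X' : TangentSpace (modelLM n) u)
    (hX : (mfderiv (modelLM n) (𝓡 n) LM.proj u X' : TangentSpace (𝓡 n) u.proj) =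
      mfderiv (𝓡 n).tangent (𝓡 n) SlitTM.proj (psi ξ hξ u) X) :
    shear n X = (∑ a, ∑ b, hHat h u a b * ξ a * ξ b)⁻¹ •
      mfderiv (modelLM n) (𝓡 n).tangent (psi ξ hξ) u (∑ i, ξ i • covariantTangent h i u X') := by
  rw [mfderiv_psi_sum_covariantTangent]
  refine Eq.trans ?_ (inv_smul_smul₀ (sum_hHat_ne_zero h u hξ) _).symm
  rw [mfderiv_LM_proj, (hasMFDerivAt_slit_proj _).mfderiv] at hX
  exact Prod.ext rfl hX.symm

end LocalForms

/-! ### The coordinate expression in an arbitrary chart. -/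

theorem mdifferentiableAt_chart {n : ℕ} {M : Type*} [TopologicalSpace M] [ChartedSpace (Vec n) M]
    {e : OpenPartialHomeomorph M (Vec n)} (he : e ∈ IsManifold.maximalAtlas (𝓡 n) ∞ M)
    {x : M} (hx : x ∈ e.source) :
    MDifferentiableAt (𝓡 n) 𝓘(ℝ, Vec n) e x :=
  (contMDiffAt_of_mem_maximalAtlas he hx).mdifferentiableAt (by simp)

theorem mfderiv_chart_injective {n : ℕ} {M : Type*} [TopologicalSpace M] [ChartedSpace (Vec n) M]
    {e : OpenPartialHomeomorph M (Vec n)}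
    (he : e ∈ IsManifold.maximalAtlas (𝓡 n) ∞ M)
    {x : M} (hx : x ∈ e.source) :
    Function.Injective (show Vec n →L[ℝ] Vec n from mfderiv (𝓡 n) 𝓘(ℝ, Vec n) e x) := by
  have h2 : MDifferentiableAt (𝓡 n) (𝓡 n) e.symm (e x) :=
    (contMDiffAt_symm_of_mem_maximalAtlas he (e.map_source hx)).mdifferentiableAt (by simp)
  have h3 := h2.hasMFDerivAt.comp x (mdifferentiableAt_chart he hx).hasMFDerivAt
  have h4 : HasMFDerivAt (𝓡 n) (𝓡 n) (e.symm ∘ e) x (ContinuousLinearMap.id ℝ (Vec n)) :=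
    (hasMFDerivAt_id x).congr_of_eventuallyEq (by
      filter_upwards [e.open_source.mem_nhds hx] with y hy using e.left_inv hy)
  have h5 := hasMFDerivAt_unique h3 h4
  exact Function.LeftInverse.injective
    (g := (show Vec n →L[ℝ] Vec n from mfderiv (𝓡 n) (𝓡 n) e.symm (e x)))
    fun w => DFunLike.congr_fun h5 w

section Chart

variable {n : ℕ} {M : Type*} [TopologicalSpace M] [ChartedSpace (Vec n) M]
  [IsManifold (𝓡 n) ∞ M]

/-- The coordinates `(x, y)` on `TM` induced by a chart `e` of `M`. -/
noncomputable def tangentCoord (e : OpenPartialHomeomorph M (Vec n)) (v : TangentBundle (𝓡 n) M) :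
    Vec n × Vec n :=
  (e v.1, mfderiv (𝓡 n) 𝓘(ℝ, Vec n) e v.1 v.2)

theorem mdifferentiableAt_tangentCoord {e : OpenPartialHomeomorph M (Vec n)}
    (he : e ∈ IsManifold.maximalAtlas (𝓡 n) ∞ M)
    {v : TangentBundle (𝓡 n) M} (hv : v.1 ∈ e.source) :
    MDifferentiableAt (𝓡 n).tangent 𝓘(ℝ, Vec n × Vec n) (tangentCoord e) v := by
  have h1 : MDifferentiableAt (𝓡 n).tangent 𝓘(ℝ, Vec n)
      (fun w : TangentBundle (𝓡 n) M => e w.1) v :=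
    MDifferentiableAt.comp (I' := 𝓡 n) v (mdifferentiableAt_chart he hv)
      (hasMFDerivAt_totalSpace_proj v).mdifferentiableAt
  -- The fibre coordinate is the second component of the tangent map of `e`, which is one order less
  -- smooth than `e`.
  have h2 := (contMDiffOn_of_mem_maximalAtlas he).contMDiffOn_tangentMapWithin (m := 1)
    (by norm_cast) e.open_source.uniqueMDiffOn
  have hmem : (TotalSpace.proj ⁻¹' e.source : Set (TangentBundle (𝓡 n) M)) ∈ 𝓝 v :=
    (FiberBundle.continuous_proj _ _).continuousAt (e.open_source.mem_nhds hv)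
  have h3 : MDifferentiableAt (𝓡 n).tangent 𝓘(ℝ, Vec n)
      (fun w : TangentBundle (𝓡 n) M => (tangentMapWithin (𝓡 n) (𝓡 n) e e.source w).2) v :=
    ((contMDiff_snd_tangentBundle_modelSpace (n := 1) (Vec n) (𝓡 n)).contMDiffAt.comp v
      (h2.contMDiffAt hmem)).mdifferentiableAt one_ne_zero
  have h4 : MDifferentiableAt (𝓡 n).tangent 𝓘(ℝ, Vec n)
      (fun w : TangentBundle (𝓡 n) M => (show Vec n from mfderiv (𝓡 n) 𝓘(ℝ, Vec n) e w.1 w.2)) v := by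
    refine h3.congr_of_eventuallyEq ?_
    filter_upwards [hmem] with w hw
    simp only [tangentMapWithin]
    rw [mfderivWithin_of_isOpen e.open_source hw]
  exact h1.prodMk_space h4

theorem mfderiv_tangentCoord_fst {e : OpenPartialHomeomorph M (Vec n)}
    (he : e ∈ IsManifold.maximalAtlas (𝓡 n) ∞ M)
    {v : TangentBundle (𝓡 n) M} (hv : v.1 ∈ e.source)
    (X : Vec n × Vec n) :
    (show Vec n × Vec n from mfderiv (𝓡 n).tangent 𝓘(ℝ, Vec n × Vec n) (tangentCoord e) v X).1 =
      mfderiv (𝓡 n) 𝓘(ℝ, Vec n) e v.1 X.1 := by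
  have h1 : HasMFDerivAt (𝓡 n).tangent 𝓘(ℝ, Vec n) (fun w => (tangentCoord e w).1) v
      ((ContinuousLinearMap.fst ℝ (Vec n) (Vec n)).comp
        (mfderiv (𝓡 n).tangent 𝓘(ℝ, Vec n × Vec n) (tangentCoord e) v)) :=
    HasMFDerivAt.comp (I' := 𝓘(ℝ, Vec n × Vec n)) v (g := Prod.fst)
      hasFDerivAt_fst.hasMFDerivAt (mdifferentiableAt_tangentCoord he hv).hasMFDerivAt
  have h2 : HasMFDerivAt (𝓡 n).tangent 𝓘(ℝ, Vec n) (fun w => (tangentCoord e w).1) v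
      ((mfderiv (𝓡 n) 𝓘(ℝ, Vec n) e v.1).comp (ContinuousLinearMap.fst ℝ (Vec n) (Vec n))) :=
    HasMFDerivAt.comp (I' := 𝓡 n) v (f := fun w : TangentBundle (𝓡 n) M => w.1)
      (mdifferentiableAt_chart he hv).hasMFDerivAt
      (hasMFDerivAt_totalSpace_proj v)
  exact DFunLike.congr_fun (hasMFDerivAt_unique h1 h2) X

/-- Along `t ↦ v + t w` the base coordinate is constant and the fibre coordinate is affine in `t`,
so no second derivative of `e` appears. -/
theorem mfderiv_tangentCoord_vertical {e : OpenPartialHomeomorph M (Vec n)}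
    (he : e ∈ IsManifold.maximalAtlas (𝓡 n) ∞ M)
    {v : TangentBundle (𝓡 n) M} (hv : v.1 ∈ e.source)
    (w : TangentSpace (𝓡 n) v.1) :
    mfderiv (𝓡 n).tangent 𝓘(ℝ, Vec n × Vec n) (tangentCoord e) v ((0, w) : Vec n × Vec n) =
      ((0, mfderiv (𝓡 n) 𝓘(ℝ, Vec n) e v.1 w) : Vec n × Vec n) := by
  let L : Vec n →L[ℝ] Vec n := mfderiv (𝓡 n) 𝓘(ℝ, Vec n) e v.1
  have hv0 : (⟨v.1, v.2 + (0:ℝ) • w⟩ : TangentBundle (𝓡 n) M) = v := by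
    refine congrArg (TotalSpace.mk v.1) ?_
    rw [zero_smul, add_zero]
  have h1 : HasMFDerivAt 𝓘(ℝ, ℝ) 𝓘(ℝ, Vec n × Vec n)
      (tangentCoord e ∘ fun t : ℝ => (⟨v.1, v.2 + t • w⟩ : TangentBundle (𝓡 n) M)) 0
      ((show Vec n × Vec n →L[ℝ] Vec n × Vec n from
        mfderiv (𝓡 n).tangent 𝓘(ℝ, Vec n × Vec n) (tangentCoord e) v).comp
        (ContinuousLinearMap.toSpanSingleton ℝ ((0, w) : Vec n × Vec n))) := by
    refine HasMFDerivAt.comp (I' := (𝓡 n).tangent) (0 : ℝ) ?_ (hasMFDerivAt_vertical_curve v w)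
    rw [hv0]
    exact (mdifferentiableAt_tangentCoord he hv).hasMFDerivAt
  have h2 : HasDerivAt (fun t : ℝ => (e v.1, L ((show Vec n from v.2) + t • (show Vec n from w))))
      (0, L w) 0 := by
    refine (hasDerivAt_const _ _).prodMk ?_
    have h := ((hasDerivAt_id (0:ℝ)).smul_const (show Vec n from w)).const_add (show Vec n from v.2)
    rw [one_smul] at h
    exact L.hasFDerivAt.comp_hasDerivAt (0 : ℝ) h
  have h3 := DFunLike.congr_fun (hasMFDerivAt_unique h1 h2.hasFDerivAt.hasMFDerivAt) (1 : ℝ)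
  refine Eq.trans ?_ (h3.trans (one_smul ℝ _))
  exact congrArg (show Vec n × Vec n →L[ℝ] Vec n × Vec n from
        mfderiv (𝓡 n).tangent 𝓘(ℝ, Vec n × Vec n) (tangentCoord e) v) (one_smul ℝ _).symm

theorem hasMFDerivAt_bundleCoord {e : OpenPartialHomeomorph M (Vec n)}
    (he : e ∈ IsManifold.maximalAtlas (𝓡 n) ∞ M)
    {p : SlitTM n M} (hp : p.proj ∈ e.source) :
    HasMFDerivAt (𝓡 n).tangent 𝓘(ℝ, Vec n × Vec n) (bundleCoord e) p
      (mfderiv (𝓡 n).tangent 𝓘(ℝ, Vec n × Vec n) (tangentCoord e) p.1) :=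
  HasMFDerivAt.comp (I' := (𝓡 n).tangent) p
    (mdifferentiableAt_tangentCoord he hp).hasMFDerivAt (hasMFDerivAt_subtype_val p)

theorem dx_eq {e : OpenPartialHomeomorph M (Vec n)}
    (he : e ∈ IsManifold.maximalAtlas (𝓡 n) ∞ M)
    {p : SlitTM n M} (hp : p.proj ∈ e.source) (i : Fin n)
    (X : TangentSpace (𝓡 n).tangent p) :
    dx e i p X = (show Vec n from
      mfderiv (𝓡 n) 𝓘(ℝ, Vec n) e p.proj (show Vec n × Vec n from X).1) i := by
  have h1 : HasMFDerivAt (𝓡 n).tangent 𝓘(ℝ, ℝ) (fun q : SlitTM n M => (bundleCoord e q).1 i) p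
      (((EuclideanSpace.proj i : Vec n →L[ℝ] ℝ).comp (ContinuousLinearMap.fst ℝ (Vec n) (Vec n))).comp
        (mfderiv (𝓡 n).tangent 𝓘(ℝ, Vec n × Vec n) (tangentCoord e) p.1)) :=
    HasMFDerivAt.comp (I' := 𝓘(ℝ, Vec n × Vec n)) p (g := fun z : Vec n × Vec n => z.1 i)
      ((EuclideanSpace.proj i : Vec n →L[ℝ] ℝ).comp
        (ContinuousLinearMap.fst ℝ (Vec n) (Vec n))).hasFDerivAt.hasMFDerivAt
      (hasMFDerivAt_bundleCoord he hp)
  rw [dx, h1.mfderiv]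
  exact congrArg (fun z : Vec n => z i) (mfderiv_tangentCoord_fst he hp X)

theorem shear_eq_sum_partialY {e : OpenPartialHomeomorph M (Vec n)}
    (he : e ∈ IsManifold.maximalAtlas (𝓡 n) ∞ M)
    {p : SlitTM n M} (hp : p.proj ∈ e.source)
    (X : TangentSpace (𝓡 n).tangent p) :
    (shear n X : TangentSpace (𝓡 n).tangent p) = ∑ i, dx e i p X • partialY e i p := by
  obtain ⟨a, b, rfl⟩ : ∃ a b : Vec n, X = ((a, b) : Vec n × Vec n) := ⟨_, _, rfl⟩
  let A : Vec n →L[ℝ] Vec n := mfderiv (𝓡 n) 𝓘(ℝ, Vec n) e p.proj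
  let D : Vec n × Vec n →L[ℝ] Vec n × Vec n :=
    mfderiv (𝓡 n).tangent 𝓘(ℝ, Vec n × Vec n) (tangentCoord e) p.1
  have hDv : ∀ w : Vec n, D (0, w) = (0, A w) := mfderiv_tangentCoord_vertical he hp
  have hA : Function.Injective A := mfderiv_chart_injective he hp
  -- `ContinuousLinearMap.inverse` is zero on non-invertible maps, so `partialY` has its meaning
  -- only once `D` is invertible. Injectivity suffices in finite dimension.
  have hD : Function.Injective D := by
    rw [injective_iff_map_eq_zero]
    rintro ⟨x, y⟩ hxy
    have hx : x = 0 := hA <| by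
      rw [map_zero, ← show (D (x, y)).1 = A x from mfderiv_tangentCoord_fst he hp (x, y), hxy]
      rfl
    subst hx
    rw [hDv] at hxy
    rw [hA ((Prod.ext_iff.1 hxy).2.trans (map_zero A).symm)]
    rfl
  let Φ : (Vec n × Vec n) ≃L[ℝ] (Vec n × Vec n) :=
    (LinearEquiv.ofInjectiveEndo D.toLinearMap hD).toContinuousLinearEquiv
  have hΦ : (Φ : Vec n × Vec n →L[ℝ] Vec n × Vec n) = D := ContinuousLinearMap.ext fun _ => rfl
  have hinv : ∀ i, partialY e i p = Φ.symm (0, stdVec i) := fun i => by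
    rw [partialY, (hasMFDerivAt_bundleCoord he hp).mfderiv]
    change D.inverse (0, stdVec i) = _
    rw [← hΦ, ContinuousLinearMap.inverse_equiv]
    rfl
  have hdx : ∀ i, dx e i p ((a, b) : Vec n × Vec n) = A a i := fun i => dx_eq he hp i _
  -- After applying `D`, this is the expansion of `A a` in the standard basis.
  have key : ((0, a) : Vec n × Vec n) = ∑ i, A a i • Φ.symm (0, stdVec i) := by
    apply Φ.injective
    rw [map_sum]
    simp only [map_smul, ContinuousLinearEquiv.apply_symm_apply]
    refine (hDv a).trans (Prod.ext ?_ ?_)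
    · simp [Prod.fst_sum]
    · rw [Prod.snd_sum]
      exact (sum_smul_stdVec (A a)).symm
  refine Eq.trans key ?_
  exact Finset.sum_congr rfl fun i _ => by rw [hdx, hinv]; rfl

end Chart

end FrameTangent

open FrameTangent in
theorem mainTheorem3 (n : ℕ) (M : Type*) [TopologicalSpace M] [ChartedSpace (Vec n) M]
    [IsManifold (𝓡 n) ∞ M] (h : Metric n M) :
    -- the denominators do not vanish
    (∀ (u : LM n M) (ξ : Vec n), ξ ≠ 0 → ∑ a, ∑ b, hHat h u a b * ξ a * ξ b ≠ 0) ∧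
    -- every point of the slit tangent bundle is of the form `[u, ξ]` with `ξ ≠ 0`
    (∀ p : SlitTM n M, ∃ (u : LM n M) (ξ : Vec n) (hξ : ξ ≠ 0), psi ξ hξ u = p) ∧
    -- every `X` has a lift to the frame bundle
    (∀ (u : LM n M) (ξ : Vec n) (hξ : ξ ≠ 0) (X : TangentSpace (𝓡 n).tangent (psi ξ hξ u)),
      ∃ X' : TangentSpace (modelLM n) u,
        (mfderiv (modelLM n) (𝓡 n) LM.proj u X' : TangentSpace (𝓡 n) u.proj) =
          mfderiv (𝓡 n).tangent (𝓡 n) SlitTM.proj (psi ξ hξ u) X) ∧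
    -- the formula defines a vector-valued 1-form, independently of `u`, `ξ` and the lift
    ∃ J : ∀ p : SlitTM n M, TangentSpace (𝓡 n).tangent p →L[ℝ] TangentSpace (𝓡 n).tangent p,
      (∀ (u : LM n M) (ξ : Vec n) (hξ : ξ ≠ 0) (X : TangentSpace (𝓡 n).tangent (psi ξ hξ u))
        (X' : TangentSpace (modelLM n) u),
        (mfderiv (modelLM n) (𝓡 n) LM.proj u X' : TangentSpace (𝓡 n) u.proj) =
          mfderiv (𝓡 n).tangent (𝓡 n) SlitTM.proj (psi ξ hξ u) X →
        J (psi ξ hξ u) X =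
          (∑ a, ∑ b, hHat h u a b * ξ a * ξ b)⁻¹ •
            mfderiv (modelLM n) (𝓡 n).tangent (psi ξ hξ) u
              (∑ i, ξ i • covariantTangent h i u X')) ∧
      -- it is the restriction of the canonical tangent structure of the tangent bundle
      (∀ (p : SlitTM n M) (X : TangentSpace (𝓡 n).tangent p),
        mfderiv (𝓡 n).tangent (𝓡 n).tangent
            (Subtype.val : SlitTM n M → TangentBundle (𝓡 n) M) p (J p X) =
          canonicalTangent p.1
            (mfderiv (𝓡 n).tangent (𝓡 n).tangent
              (Subtype.val : SlitTM n M → TangentBundle (𝓡 n) M) p X)) ∧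
      -- in the coordinates induced by any chart it is `∂/∂yⁱ ⊗ dxⁱ`
      (∀ e ∈ IsManifold.maximalAtlas (𝓡 n) ∞ M, ∀ p : SlitTM n M, p.proj ∈ e.source →
        ∀ X : TangentSpace (𝓡 n).tangent p,
          J p X = ∑ i, dx e i p X • partialY e i p) :=
  ⟨fun u _ hξ => sum_hHat_ne_zero h u hξ, exists_psi_eq, exists_lift, fun _ => shear n,
    fun u ξ hξ X X' hX => shear_psi_eq h u ξ hξ X X' hX,
    fun p X => by
      rw [canonicalTangent_eq, mfderiv_slit_val]
      rfl,
    fun _ he _ hp X => shear_eq_sum_partialY he hp X⟩
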